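/- Let $D\subset\mathbb{C}$ be a region (a non-empty connected open set) and let $f_n$ be analytic functions in $D$. Let $n_1<n_2<\cdots$ be positive integers (for instance $n_k=k$). Call a sequence of functions $w_k:D\to[-\infty,\infty)$ convergent to $w$ in $D$ if either $w$ is a subharmonic function in $D$, not identically $-\infty$, and $w_k\to w$ in $L^1_{\mathrm{loc}}(D)$; or $w\equiv-\infty$ in $D$ and $w_k\to-\infty$ uniformly on compact subsets of $D$. Suppose that, in this sense, $$\frac1{n_k}\log|f_{n_k}|\to u\quad\text{and}\quad \frac1{n_k}\log|f_{n_k}'|\to v\qquad (k\to\infty)$$ in $D$, where $u\not\equiv-\infty$ (and $\log 0=-\infty$). Then $v(z)\le u(z)$ for every $z\in D$. Moreover, if $v(z_0)<u(z_0)$ at some point $z_0\in D$, then there is a neighbourhood $V\subset D$ of $z_0$ such that $u$ is constant on $V$. -/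

import Mathlib

open MeasureTheory Filter Topology Set

noncomputable section

/-- The mean over the circle `|z - c| = r` of an extended real valued function, as the mean of its
positive part minus the mean of its negative part. For an upper semicontinuous function `< ⊤`
the first term is finite, so that no indeterminate difference occurs. -/
def circleMean (u : ℂ → EReal) (c : ℂ) (r : ℝ) : EReal :=
  ((⨍⁻ θ in Ioc (0 : ℝ) (2 * Real.pi), (u (circleMap c r θ)).toENNReal ∂volume : ENNReal) : EReal) -
    ((⨍⁻ θ in Ioc (0 : ℝ) (2 * Real.pi), (-u (circleMap c r θ)).toENNReal ∂volume : ENNReal) : EReal)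

/-- Subharmonic functions on an open set `D`, with values in `[-∞, ∞)`; the constant `-∞` is not
excluded here. -/
structure SubharmonicOn (u : ℂ → EReal) (D : Set ℂ) : Prop where
  upperSemicontinuousOn : UpperSemicontinuousOn u D
  lt_top : ∀ z ∈ D, u z < ⊤
  le_circleMean : ∀ z ∈ D, ∀ r : ℝ, 0 < r → Metric.closedBall z r ⊆ D → u z ≤ circleMean u z r

/-- The function `(1/n) log |f|`, with value `-∞` at the zeros of `f` (for `n ≥ 1`). -/
def scaledLog (n : ℕ) (f : ℂ → ℂ) (z : ℂ) : EReal :=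
  ((1 / (n : ℝ) : ℝ) : EReal) * ENNReal.log ‖f z‖ₑ

/-- Convergence `w k → u` in `L¹_loc(D)`. -/
def TendstoL1Loc (D : Set ℂ) (w : ℕ → ℂ → EReal) (u : ℂ → EReal) : Prop :=
  ∀ K ⊆ D, IsCompact K → Tendsto (fun k => ∫⁻ z in K, (w k z - u z).abs) atTop (𝓝 0)

/-- Convergence `w k → -∞`, uniformly on compact subsets of `D`. -/
def TendstoBotLocUniformly (D : Set ℂ) (w : ℕ → ℂ → EReal) : Prop :=
  ∀ K ⊆ D, IsCompact K → ∀ M : ℝ, ∀ᶠ k in atTop, ∀ z ∈ K, w k z ≤ (M : EReal)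

/-- Convergence of a sequence of subharmonic functions in a region `D`: either the limit `u` is
subharmonic, not identically `-∞`, and the convergence is in `L¹_loc(D)`; or `u` is identically
`-∞` and the convergence is uniform on compact subsets. -/
def TendstoSubharmonic (D : Set ℂ) (w : ℕ → ℂ → EReal) (u : ℂ → EReal) : Prop :=
  (SubharmonicOn u D ∧ (∃ z ∈ D, u z ≠ ⊥) ∧ TendstoL1Loc D w u) ∨
    ((∀ z ∈ D, u z = ⊥) ∧ TendstoBotLocUniformly D w)

end

/-! Two transfers between limit and sequence carry the proof. Hartogs' lemma
(`TendstoSubharmonic.eventually_forall_ball_le`): if `u z < M`, then eventually `|f| ≤ e^(nM)` on a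
fixed ball about `z`. Conversely (`TendstoSubharmonic.eventually_exists_ball_lt`), if `M < u z`,
small balls about `z` eventually contain a point where `|f| > e^(nM)`; likewise for `v` and `f'`.
Cauchy's estimate costs only a constant factor, negligible against `e^(nε)`, so `v ≤ u`. If `v z₀ <
a < u z₀`, then `|f'| ≤ e^(na)` on a ball, so `f` oscillates there by `O(e^(na))`. This is too
little for `u` to drop from a value above `a`, so `u` is constant there. -/

/-! ### Sub-mean value inequalities for analytic functions -/

lemma AnalyticOnNhd.log_norm_le_circleAverage {g : ℂ → ℂ} {c : ℂ} {R : ℝ} (hR : 0 < R)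
    (hg : AnalyticOnNhd ℂ g (Metric.closedBall c R)) (hc : g c ≠ 0) :
    Real.log ‖g c‖ ≤ Real.circleAverage (fun z => Real.log ‖g z‖) c R := by
  rw [← abs_of_pos hR] at hg
  rw [hg.circleAverage_log_norm hR.ne' hc]
  -- In Jensen's formula a zero `y` contributes its multiplicity times `log (R / |c - y|) ≥ 0`.
  refine le_add_of_nonneg_left (finsum_nonneg fun y => ?_)
  by_cases hy : y ∈ Metric.closedBall c |R|
  · refine mul_nonneg ?_ ?_
    · have := MeromorphicOn.AnalyticOnNhd.divisor_nonneg hg y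
      exact_mod_cast this
    · rcases eq_or_ne c y with rfl | hne
      · simp
      · refine Real.log_nonneg ?_
        have h1 : 0 < ‖c - y‖ := norm_pos_iff.2 (sub_ne_zero.2 hne)
        rw [← div_eq_mul_inv, one_le_div h1]
        rwa [Metric.mem_closedBall, dist_comm, dist_eq_norm, abs_of_pos hR] at hy
  · simp [hy]

lemma AnalyticOnNhd.posLog_norm_le_circleAverage {g : ℂ → ℂ} {c : ℂ} {R : ℝ} (hR : 0 < R)
    (hg : AnalyticOnNhd ℂ g (Metric.closedBall c R)) :
    Real.posLog ‖g c‖ ≤ Real.circleAverage (fun z => Real.posLog ‖g z‖) c R := by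
  rcases le_total (Real.log ‖g c‖) 0 with h | h
  · rw [Real.posLog, max_eq_left h]
    exact Real.circleAverage_nonneg_of_nonneg fun _ _ => Real.posLog_nonneg
  · rw [Real.posLog, max_eq_right h]
    rcases eq_or_ne (g c) 0 with h0 | h0
    · rw [h0, norm_zero, Real.log_zero]
      exact Real.circleAverage_nonneg_of_nonneg fun _ _ => Real.posLog_nonneg
    · refine (hg.log_norm_le_circleAverage hR h0).trans ?_
      have hm : MeromorphicOn g (Metric.sphere c |R|) := by
        rw [abs_of_pos hR]
        exact fun x hx => (hg x (Metric.sphere_subset_closedBall hx)).meromorphicAt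
      exact Real.circleAverage_mono hm.circleIntegrable_log_norm hm.circleIntegrable_posLog_norm
        fun x _ => le_max_right _ _

lemma AnalyticOnNhd.ofReal_posLog_norm_le_lintegral {g : ℂ → ℂ}
    (hg : AnalyticOnNhd ℂ g (Metric.closedBall 0 1)) :
    ENNReal.ofReal (2 * Real.pi) * ENNReal.ofReal (Real.posLog ‖g 0‖) ≤
      ∫⁻ θ in Ioc (0 : ℝ) (2 * Real.pi), ENNReal.ofReal (Real.posLog ‖g (circleMap 0 1 θ)‖) := by
  have h := hg.posLog_norm_le_circleAverage one_pos
  have hm : MeromorphicOn g (Metric.sphere 0 |1|) := by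
    rw [abs_of_pos one_pos]
    exact fun x hx => (hg x (Metric.sphere_subset_closedBall hx)).meromorphicAt
  have hi : CircleIntegrable (fun z => Real.posLog ‖g z‖) 0 1 := hm.circleIntegrable_posLog_norm
  rw [CircleIntegrable, intervalIntegrable_iff_integrableOn_Ioc_of_le Real.two_pi_pos.le] at hi
  rw [Real.circleAverage_def, smul_eq_mul, le_inv_mul_iff₀ Real.two_pi_pos,
    intervalIntegral.integral_of_le Real.two_pi_pos.le] at h
  rw [← ENNReal.ofReal_mul Real.two_pi_pos.le, ← ofReal_integral_eq_lintegral_ofReal hi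
    (Eventually.of_forall fun _ => Real.posLog_nonneg)]
  exact ENNReal.ofReal_le_ofReal h

lemma measurePreserving_circleMap_mul (θ : ℝ) :
    MeasurePreserving (fun w : ℂ => circleMap 0 1 θ * w) := by
  have h := (rotation (Circle.exp θ)).measurePreserving
  convert h using 2 with w
  simp [circleMap]

lemma setLIntegral_ball_rotate {G : ℂ → ENNReal} (ζ : ℂ) (r θ : ℝ) (hG : Measurable G) :
    ∫⁻ w in Metric.ball 0 r, G (ζ + circleMap 0 1 θ * w) = ∫⁻ y in Metric.ball ζ r, G y := by
  have h : MeasurePreserving (fun w : ℂ => ζ + circleMap 0 1 θ * w) :=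
    (measurePreserving_add_left volume ζ).comp (measurePreserving_circleMap_mul θ)
  rw [← h.setLIntegral_comp_preimage measurableSet_ball hG]
  congr 2
  ext w
  simp [dist_eq_norm]

/-- Integrate over `w` and swap by Tonelli: rotations preserve area, so each angle gives the same
integral over the ball. This replaces polar coordinates. -/
lemma lintegral_ball_le_of_le_lintegral_circle {G : ℂ → ENNReal} {ζ : ℂ} {r : ℝ}
    (hG : Measurable G) {a : ENNReal}
    (h : ∀ w ∈ Metric.ball (0 : ℂ) r, ENNReal.ofReal (2 * Real.pi) * a ≤
      ∫⁻ θ in Ioc (0 : ℝ) (2 * Real.pi), G (ζ + circleMap 0 1 θ * w)) :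
    a * volume (Metric.ball (0 : ℂ) r) ≤ ∫⁻ y in Metric.ball ζ r, G y := by
  have hpi : ENNReal.ofReal (2 * Real.pi) ≠ 0 := by simp [Real.pi_pos]
  rw [← ENNReal.mul_le_mul_iff_right hpi ENNReal.ofReal_ne_top, ← mul_assoc]
  calc _ = ∫⁻ w in Metric.ball (0 : ℂ) r, ENNReal.ofReal (2 * Real.pi) * a := by
        rw [setLIntegral_const]
    _ ≤ ∫⁻ w in Metric.ball (0 : ℂ) r, ∫⁻ θ in Ioc (0 : ℝ) (2 * Real.pi),
          G (ζ + circleMap 0 1 θ * w) := setLIntegral_mono' measurableSet_ball h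
    _ = ∫⁻ θ in Ioc (0 : ℝ) (2 * Real.pi), ∫⁻ w in Metric.ball (0 : ℂ) r,
          G (ζ + circleMap 0 1 θ * w) := by
        refine lintegral_lintegral_swap (Measurable.aemeasurable ?_)
        exact hG.comp (Continuous.measurable (by fun_prop))
    _ = _ := by
        simp_rw [setLIntegral_ball_rotate ζ r _ hG]
        rw [setLIntegral_const, Real.volume_Ioc, sub_zero, mul_comm]

/-- The area sub-mean value property of `log⁺ |g|`. -/
lemma AnalyticOnNhd.posLog_mul_volume_le {g : ℂ → ℂ} {ζ : ℂ} {r : ℝ}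
    (hg : AnalyticOnNhd ℂ g (Metric.ball ζ r)) :
    ENNReal.ofReal (Real.posLog ‖g ζ‖) * volume (Metric.ball (0 : ℂ) r) ≤
      ∫⁻ y in Metric.ball ζ r, ENNReal.ofReal (Real.posLog ‖g y‖) := by
  classical
  set G : ℂ → ENNReal :=
    (Metric.ball ζ r).piecewise (fun y => ENNReal.ofReal (Real.posLog ‖g y‖)) 0 with hGdef
  have hGm : Measurable G := by
    refine ContinuousOn.measurable_piecewise ?_ continuousOn_const measurableSet_ball
    exact ENNReal.continuous_ofReal.comp_continuousOn
      (Real.continuous_posLog.comp_continuousOn hg.continuousOn.norm)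
  have hGeq : ∀ y ∈ Metric.ball ζ r, G y = ENNReal.ofReal (Real.posLog ‖g y‖) :=
    fun y hy => piecewise_eq_of_mem _ _ _ hy
  rw [← setLIntegral_congr_fun measurableSet_ball hGeq]
  refine lintegral_ball_le_of_le_lintegral_circle hGm fun w hw => ?_
  have hmem : ∀ x ∈ Metric.closedBall (0 : ℂ) 1, ζ + x * w ∈ Metric.ball ζ r := by
    intro x hx
    simp only [Metric.mem_closedBall, dist_zero_right, Metric.mem_ball, dist_self_add_left,
      norm_mul] at hx hw ⊢
    exact (mul_le_of_le_one_left (norm_nonneg _) hx).trans_lt hw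
  -- The circle of radius `‖w‖` about `ζ` is parametrized by the unit circle, which also covers `w =
  -- 0`.
  have hh : AnalyticOnNhd ℂ (fun x => g (ζ + x * w)) (Metric.closedBall 0 1) := by
    refine AnalyticOnNhd.comp hg ?_ hmem
    exact analyticOnNhd_const.add (analyticOnNhd_id.mul analyticOnNhd_const)
  have := hh.ofReal_posLog_norm_le_lintegral
  simp only [zero_mul, add_zero] at this
  refine this.trans (le_of_eq (lintegral_congr fun θ => (hGeq _ (hmem _ ?_)).symm))
  simp

/-! ### From almost everywhere bounds to pointwise bounds -/

lemma circleMean_le_of_ae_le {v : ℂ → EReal} {z : ℂ} {ρ M : ℝ}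
    (h : ∀ᵐ θ : ℝ, v (circleMap z ρ θ) ≤ M) : circleMean v z ρ ≤ M := by
  have hp : volume (Ioc (0 : ℝ) (2 * Real.pi)) ≠ 0 := by simp [Real.pi_pos]
  have ht : volume (Ioc (0 : ℝ) (2 * Real.pi)) ≠ ⊤ := measure_Ioc_lt_top.ne
  have : NeZero (volume.restrict (Ioc (0 : ℝ) (2 * Real.pi))) := ⟨by
    rwa [Ne, Measure.restrict_eq_zero]⟩
  have h' := ae_restrict_of_ae (s := Ioc (0 : ℝ) (2 * Real.pi)) h
  rw [circleMean]
  -- For `M ≥ 0` the negative part can be dropped; for `M ≤ 0` the positive part vanishes.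
  rcases le_total 0 M with hM | hM
  · have h1 : ⨍⁻ θ in Ioc (0 : ℝ) (2 * Real.pi), (v (circleMap z ρ θ)).toENNReal ∂volume ≤
        ENNReal.ofReal M := by
      calc _ ≤ ⨍⁻ θ in Ioc (0 : ℝ) (2 * Real.pi), ENNReal.ofReal M ∂volume := by
            refine laverage_mono_ae ?_
            filter_upwards [h'] with θ hθ
            exact EReal.toENNReal_le_toENNReal hθ
        _ = _ := laverage_const _ _
    have h2 : ((ENNReal.ofReal M : ENNReal) : EReal) = M := by
      rw [EReal.coe_ennreal_ofReal, max_eq_left hM]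
    rw [← h2, sub_eq_add_neg]
    refine (add_le_of_nonpos_right ?_).trans (EReal.coe_ennreal_le_coe_ennreal_iff.2 h1)
    rw [EReal.neg_le, neg_zero]
    exact EReal.coe_ennreal_nonneg _
  · have h1 : ⨍⁻ θ in Ioc (0 : ℝ) (2 * Real.pi), (v (circleMap z ρ θ)).toENNReal ∂volume = 0 := by
      rw [laverage_eq', ← lintegral_zero]
      refine lintegral_congr_ae ?_
      refine (Measure.ae_smul_measure h' _).mono fun θ hθ => ?_
      exact EReal.toENNReal_of_nonpos (hθ.trans (by exact_mod_cast hM))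
    have h2 : ENNReal.ofReal (-M) ≤
        ⨍⁻ θ in Ioc (0 : ℝ) (2 * Real.pi), (-v (circleMap z ρ θ)).toENNReal ∂volume := by
      calc _ = ⨍⁻ θ in Ioc (0 : ℝ) (2 * Real.pi), ENNReal.ofReal (-M) ∂volume := (laverage_const _ _).symm
        _ ≤ _ := by
            refine laverage_mono_ae ?_
            filter_upwards [h'] with θ hθ
            exact EReal.toENNReal_le_toENNReal (x := ((-M : ℝ) : EReal)) (by
              rw [EReal.coe_neg]; exact EReal.neg_le_neg_iff.2 hθ)
    rw [h1]
    have h3 : ((ENNReal.ofReal (-M) : ENNReal) : EReal) = -(M : EReal) := by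
      rw [EReal.coe_ennreal_ofReal, max_eq_left (by linarith), EReal.coe_neg]
    have h4 := EReal.coe_ennreal_le_coe_ennreal_iff.2 h2
    rw [h3] at h4
    simpa using EReal.neg_le.1 h4

/-- By Fubini over rotations, almost every circle about `z` meets a null set in a null set of
angles. -/
lemma exists_circle_ae_of_ae_ball {p : ℂ → Prop} {z : ℂ} {r : ℝ} (hr : 0 < r)
    (h : ∀ᵐ y ∂volume.restrict (Metric.ball z r), p y) :
    ∃ ρ, 0 < ρ ∧ ρ < r ∧ ∀ᵐ θ : ℝ, p (circleMap z ρ θ) := by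
  obtain ⟨t, htsub, htm, ht0⟩ := exists_measurable_superset_of_null
    ((ae_restrict_iff' measurableSet_ball).1 h)
  have hrot : ∀ θ : ℝ, ∀ᵐ w : ℂ, z + circleMap 0 1 θ * w ∉ t := fun θ =>
    ((measurePreserving_add_left volume z).comp
      (measurePreserving_circleMap_mul θ)).quasiMeasurePreserving.ae
      (measure_eq_zero_iff_ae_notMem.1 ht0)
  have hsw : ∀ᵐ w : ℂ, ∀ᵐ θ : ℝ, z + circleMap 0 1 θ * w ∉ t := by
    refine (Measure.ae_ae_comm ?_).1 (Eventually.of_forall hrot)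
    have : Measurable fun x : ℝ × ℂ => z + circleMap 0 1 x.1 * x.2 :=
      Continuous.measurable (by fun_prop)
    exact this htm.compl
  have hne : ∃ᶠ w in ae (volume : Measure ℂ), w ∈ Metric.ball (0 : ℂ) r := by
    rw [frequently_ae_mem_iff]
    exact (Metric.measure_ball_pos volume 0 hr).ne'
  obtain ⟨w, hwr, hw, hw0⟩ := (hne.and_eventually (hsw.and (Measure.ae_ne volume (0 : ℂ)))).exists
  have hw0' : 0 < ‖w‖ := norm_pos_iff.2 hw0
  have hwr' : ‖w‖ < r := by simpa using hwr
  refine ⟨‖w‖, hw0', hwr', ?_⟩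
  -- Shifting by `arg w` turns the rotated `w` into the standard parametrization.
  have hs := (measurePreserving_add_right (volume : Measure ℝ)
    (-Complex.arg w)).quasiMeasurePreserving.ae hw
  filter_upwards [hs] with θ hθ
  have heq : z + circleMap 0 1 (θ + -Complex.arg w) * w = circleMap z ‖w‖ θ := by
    nth_rw 2 [← Complex.norm_mul_exp_arg_mul_I w]
    simp only [circleMap, zero_add, Complex.ofReal_one, one_mul, add_right_inj]
    rw [mul_left_comm, ← Complex.exp_add]
    push_cast
    ring_nf
  rw [heq] at hθ
  by_contra hp
  refine hθ (htsub ?_)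
  simp only [mem_compl_iff, mem_ofPred_eq, Classical.not_imp]
  exact ⟨by simp [circleMap, hwr'], hp⟩

lemma SubharmonicOn.le_of_ae_le {v : ℂ → EReal} {D : Set ℂ} (hv : SubharmonicOn v D) {z : ℂ}
    {r M : ℝ} (hr : 0 < r) (hD : Metric.ball z r ⊆ D)
    (h : ∀ᵐ y ∂volume.restrict (Metric.ball z r), v y ≤ M) : v z ≤ M := by
  obtain ⟨ρ, hρ, hρr, hae⟩ := exists_circle_ae_of_ae_ball hr h
  exact (hv.le_circleMean z (hD (Metric.mem_ball_self hr)) ρ hρ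
    ((Metric.closedBall_subset_ball hρr).trans hD)).trans (circleMean_le_of_ae_le hae)


/-! ### Hartogs' lemma -/

lemma scaledLog_of_ne_zero {n : ℕ} {f : ℂ → ℂ} {z : ℂ} (h : f z ≠ 0) :
    scaledLog n f z = ((Real.log ‖f z‖ / n : ℝ) : EReal) := by
  rw [scaledLog, ← ofReal_norm, ENNReal.log_ofReal_of_pos (norm_pos_iff.2 h), ← EReal.coe_mul]
  congr 1
  ring

lemma scaledLog_of_eq_zero {n : ℕ} (hn : 0 < n) {f : ℂ → ℂ} {z : ℂ} (h : f z = 0) :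
    scaledLog n f z = ⊥ := by
  have : (0 : ℝ) < 1 / n := by positivity
  rw [scaledLog, h, enorm_zero, ENNReal.log_zero, EReal.coe_mul_bot_of_pos this]

lemma scaledLog_le_iff {n : ℕ} (hn : 0 < n) {f : ℂ → ℂ} {z : ℂ} {c : ℝ} :
    scaledLog n f z ≤ c ↔ ‖f z‖ ≤ Real.exp (n * c) := by
  rcases eq_or_ne (f z) 0 with h | h
  · simp [scaledLog_of_eq_zero hn h, h, Real.exp_nonneg]
  · have hn' : (0 : ℝ) < n := by exact_mod_cast hn
    rw [scaledLog_of_ne_zero h, EReal.coe_le_coe_iff, div_le_iff₀ hn',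
      Real.log_le_iff_le_exp (norm_pos_iff.2 h), mul_comm]

lemma lt_scaledLog_iff {n : ℕ} (hn : 0 < n) {f : ℂ → ℂ} {z : ℂ} {c : ℝ} :
    c < scaledLog n f z ↔ Real.exp (n * c) < ‖f z‖ := by
  rw [← not_le, scaledLog_le_iff hn, not_le]

lemma EReal.toENNReal_sub_le_abs_of_le {a x : EReal} {M : ℝ} (hx : x ≤ M) :
    (a - M).toENNReal ≤ (a - x).abs := by
  induction a with
  | bot => simp
  | top =>
    induction x with
    | bot => simp
    | top => simp at hx
    | coe x => simp
  | coe a =>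
    induction x with
    | bot => simp
    | top => simp at hx
    | coe x =>
      rw [← EReal.coe_sub, ← EReal.coe_sub, EReal.abs_def, EReal.toENNReal_of_ne_top (EReal.coe_ne_top _), EReal.toReal_coe]
      rw [EReal.coe_le_coe_iff] at hx
      exact ENNReal.ofReal_le_ofReal ((by linarith : a - M ≤ a - x).trans (le_abs_self _))

lemma EReal.toENNReal_sub_le_abs_of_ge {a x : EReal} {M : ℝ} (hx : x ≤ M) :
    (a - M).toENNReal ≤ (x - a).abs := by
  induction a with
  | bot => simp
  | top => simp
  | coe a =>
    induction x with
    | bot => simp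
    | top => simp at hx
    | coe x =>
      rw [← EReal.coe_sub, ← EReal.coe_sub, EReal.abs_def, EReal.toENNReal_of_ne_top (EReal.coe_ne_top _), EReal.toReal_coe]
      rw [EReal.coe_le_coe_iff] at hx
      exact ENNReal.ofReal_le_ofReal
        ((by linarith : a - M ≤ -(x - a)).trans (neg_le_abs _))

/-- The factor `e^(-nM)` turns `n` times the excess of `scaledLog` over `M` into `log⁺` of an
analytic function. -/
lemma ofReal_posLog_le_mul_abs {n : ℕ} (hn : 0 < n) {f : ℂ → ℂ} {z : ℂ} {x : EReal} {M : ℝ}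
    (hx : x ≤ M) :
    ENNReal.ofReal (Real.posLog ‖f z * (Real.exp (-(n * M)) : ℂ)‖) ≤
      n * (scaledLog n f z - x).abs := by
  have hn' : (0 : ℝ) < n := by exact_mod_cast hn
  rcases eq_or_ne (f z) 0 with h | h
  · simp [h]
  · refine le_trans ?_ (mul_le_mul_right (EReal.toENNReal_sub_le_abs_of_le hx) (n : ENNReal))
    rw [scaledLog_of_ne_zero h, ← EReal.coe_sub, EReal.toENNReal_of_ne_top (EReal.coe_ne_top _), EReal.toReal_coe,
      ← ENNReal.ofReal_natCast, ← ENNReal.ofReal_mul hn'.le, norm_mul, Complex.norm_real,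
      Real.norm_of_nonneg (Real.exp_nonneg _), Real.posLog_apply,
      Real.log_mul (norm_ne_zero_iff.2 h) (Real.exp_ne_zero _), Real.log_exp]
    rw [show (n : ℝ) * (Real.log ‖f z‖ / n - M) = Real.log ‖f z‖ + -(n * M) by field_simp; ring]
    rw [ENNReal.ofReal_max]
    simp

/-- A value above `M` at the centre would force, by the area inequality for `f e^(-nM')`, a large
`L¹` distance to `u`. The set `K` lets one integral serve many centres. -/
lemma AnalyticOnNhd.scaledLog_le_of_lintegral_lt {f : ℂ → ℂ} {z : ℂ} {r M M' : ℝ} {n : ℕ}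
    (hn : 0 < n) {u : ℂ → EReal} {K : Set ℂ} (hK : Metric.ball z r ⊆ K)
    (hf : AnalyticOnNhd ℂ f (Metric.ball z r)) (hu : ∀ y ∈ Metric.ball z r, u y ≤ M')
    (h : ∫⁻ y in K, (scaledLog n f y - u y).abs <
      ENNReal.ofReal (M - M') * volume (Metric.ball (0 : ℂ) r)) :
    scaledLog n f z ≤ M := by
  by_contra! hlt
  have hn' : (0 : ℝ) < n := by exact_mod_cast hn
  rw [lt_scaledLog_iff hn] at hlt
  have hg : AnalyticOnNhd ℂ (fun y => f y * (Real.exp (-(n * M')) : ℂ)) (Metric.ball z r) :=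
    hf.mul analyticOnNhd_const
  have h1 : (n : ENNReal) * ENNReal.ofReal (M - M') ≤
      ENNReal.ofReal (Real.posLog ‖f z * (Real.exp (-(n * M')) : ℂ)‖) := by
    rw [← ENNReal.ofReal_natCast, ← ENNReal.ofReal_mul hn'.le]
    refine ENNReal.ofReal_le_ofReal (le_trans ?_ (le_max_right _ _))
    have h0 : 0 < ‖f z‖ := (Real.exp_pos _).trans hlt
    rw [norm_mul, Complex.norm_real, Real.norm_of_nonneg (Real.exp_nonneg _),
      Real.log_mul h0.ne' (Real.exp_ne_zero _), Real.log_exp]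
    have := (Real.lt_log_iff_exp_lt h0).2 hlt
    linarith
  have h2 : (n : ENNReal) * (ENNReal.ofReal (M - M') * volume (Metric.ball (0 : ℂ) r)) ≤
      n * ∫⁻ y in K, (scaledLog n f y - u y).abs := by
    calc _ = n * ENNReal.ofReal (M - M') * volume (Metric.ball (0 : ℂ) r) := by ring
      _ ≤ _ := mul_le_mul_left h1 _
      _ ≤ _ := hg.posLog_mul_volume_le
      _ ≤ ∫⁻ y in Metric.ball z r, n * (scaledLog n f y - u y).abs :=
          setLIntegral_mono' measurableSet_ball fun y hy => ofReal_posLog_le_mul_abs hn (hu y hy)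
      _ = n * ∫⁻ y in Metric.ball z r, (scaledLog n f y - u y).abs :=
          lintegral_const_mul' _ _ (ENNReal.natCast_ne_top n)
      _ ≤ _ := mul_le_mul_right (lintegral_mono_set hK) _
  rw [ENNReal.mul_le_mul_iff_right (by exact_mod_cast hn.ne') (ENNReal.natCast_ne_top n)] at h2
  exact absurd h (not_lt.2 h2)

/-- Hartogs' lemma: upper bounds of the limit are locally eventually upper bounds. -/
lemma TendstoSubharmonic.eventually_forall_ball_le {D : Set ℂ} (hDo : IsOpen D)
    {f : ℕ → ℂ → ℂ} (hf : ∀ n, AnalyticOnNhd ℂ (f n) D) {ν : ℕ → ℕ}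
    (hν : Tendsto ν atTop atTop) {u : ℂ → EReal}
    (hu : TendstoSubharmonic D (fun k => scaledLog (ν k) (f (ν k))) u) {z : ℂ} (hz : z ∈ D)
    {M : ℝ} (hM : u z < M) :
    ∃ r > 0, ∀ᶠ k in atTop, ∀ y ∈ Metric.ball z r, scaledLog (ν k) (f (ν k)) y ≤ M := by
  rcases hu with ⟨hsub, -, hL⟩ | ⟨-, hb⟩
  · obtain ⟨M', hM'1, hM'2⟩ := EReal.lt_iff_exists_real_btwn.1 hM
    have hnear := hsub.upperSemicontinuousOn z hz M' hM'1
    rw [hDo.nhdsWithin_eq hz] at hnear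
    obtain ⟨s, hs, hball⟩ := Metric.eventually_nhds_iff_ball.1 (hnear.and (hDo.mem_nhds hz))
    -- Balls of radius `r` centred in `ball z r` all lie in `closedBall z (2 * r)`.
    set r := s / 3 with hr
    have hr0 : 0 < r := by positivity
    have hKD : Metric.closedBall z (2 * r) ⊆ Metric.ball z s :=
      Metric.closedBall_subset_ball (by linarith)
    have hpos : 0 < ENNReal.ofReal (M - M') * volume (Metric.ball (0 : ℂ) r) :=
      ENNReal.mul_pos
        (ENNReal.ofReal_pos.2 (sub_pos.2 (EReal.coe_lt_coe_iff.1 hM'2))).ne'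
        (Metric.measure_ball_pos volume _ hr0).ne'
    refine ⟨r, hr0, ?_⟩
    filter_upwards [(hL _ (fun y hy => (hball y (hKD hy)).2)
      (isCompact_closedBall z (2 * r))).eventually_lt_const hpos,
      hν.eventually_gt_atTop 0] with k hk hνk y hy
    have hsubset : Metric.ball y r ⊆ Metric.closedBall z (2 * r) :=
      Metric.ball_subset_closedBall.trans
        (Metric.closedBall_subset_closedBall' (by rw [Metric.mem_ball] at hy; linarith))
    exact AnalyticOnNhd.scaledLog_le_of_lintegral_lt hνk hsubset
      ((hf _).mono fun x hx => (hball x (hKD (hsubset hx))).2)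
      (fun x hx => (hball x (hKD (hsubset hx))).1.le) hk
  · obtain ⟨r, hr, hrD⟩ := Metric.nhds_basis_closedBall.mem_iff.1 (hDo.mem_nhds hz)
    refine ⟨r, hr, (hb _ hrD (isCompact_closedBall z r) M).mono fun k hk y hy => ?_⟩
    exact hk y (Metric.ball_subset_closedBall hy)

/-! ### Lower bounds of the limit -/

lemma UpperSemicontinuousOn.aemeasurable_restrict {u : ℂ → EReal} {s : Set ℂ}
    (hu : UpperSemicontinuousOn u s) (hs : MeasurableSet s) :
    AEMeasurable u (volume.restrict s) := by
  rw [aemeasurable_restrict_iff_comap_subtype hs]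
  exact (upperSemicontinuousOn_iff_restrict.2 hu).measurable.aemeasurable

/-- Where `w k ≤ M`, the excess `(u - M)⁺` is at most `|w k - u|`; so its integral is zero, and `u ≤
M` almost everywhere on the ball. -/
lemma TendstoL1Loc.le_of_frequently_le {D : Set ℂ} {w : ℕ → ℂ → EReal} {u : ℂ → EReal}
    (hu : SubharmonicOn u D) (hw : TendstoL1Loc D w u) {z : ℂ} {r M : ℝ} (hr : 0 < r)
    (hD : Metric.closedBall z r ⊆ D)
    (h : ∃ᶠ k in atTop, ∀ y ∈ Metric.ball z r, w k y ≤ M) : u z ≤ M := by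
  have hbD := Metric.ball_subset_closedBall.trans hD
  have hmono : Monotone fun x : EReal => (x - M).toENNReal := fun x y hxy =>
    EReal.toENNReal_le_toENNReal (EReal.sub_le_sub hxy le_rfl)
  have hm : AEMeasurable (fun y => (u y - M).toENNReal) (volume.restrict (Metric.ball z r)) :=
    hmono.measurable.comp_aemeasurable
      ((hu.upperSemicontinuousOn.mono hbD).aemeasurable_restrict measurableSet_ball)
  have h0 : ∫⁻ y in Metric.ball z r, (u y - M).toENNReal ≤ 0 := by
    refine ge_of_tendsto_of_frequently (hw _ hD (isCompact_closedBall z r)) (h.mono fun k hk => ?_)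
    exact (setLIntegral_mono' measurableSet_ball fun y hy =>
      EReal.toENNReal_sub_le_abs_of_ge (hk y hy)).trans
        (lintegral_mono_set Metric.ball_subset_closedBall)
  rw [nonpos_iff_eq_zero, lintegral_eq_zero_iff' hm] at h0
  refine hu.le_of_ae_le hr hbD (h0.mono fun y hy => ?_)
  simp only [Pi.zero_apply, EReal.toENNReal_eq_zero_iff] at hy
  exact EReal.sub_nonpos.1 hy

lemma TendstoSubharmonic.eventually_exists_ball_lt {D : Set ℂ} {w : ℕ → ℂ → EReal}
    {u : ℂ → EReal} (hu : TendstoSubharmonic D w u) {z : ℂ} {r M : ℝ} (hr : 0 < r)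
    (hD : Metric.closedBall z r ⊆ D) (hM : M < u z) :
    ∀ᶠ k in atTop, ∃ y ∈ Metric.ball z r, M < w k y := by
  rcases hu with ⟨hsub, -, hL⟩ | ⟨hb, -⟩
  · by_contra hcon
    rw [not_eventually] at hcon
    refine absurd hM (not_lt.2 (hL.le_of_frequently_le hsub hr hD (hcon.mono fun k hk => ?_)))
    push Not at hk
    exact hk
  · rw [hb z (hD (Metric.mem_closedBall_self hr.le))] at hM
    exact absurd hM not_lt_bot

/-! ### Comparison of `f` and `f'` -/

lemma eventually_mul_exp_lt {a b c : ℝ} (h : a < b) {ν : ℕ → ℕ} (hν : Tendsto ν atTop atTop) :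
    ∀ᶠ k in atTop, c * Real.exp (ν k * a) < Real.exp (ν k * b) := by
  have ht : Tendsto (fun k => Real.exp (ν k * (b - a))) atTop atTop :=
    Real.tendsto_exp_atTop.comp
      ((tendsto_natCast_atTop_atTop.comp hν).atTop_mul_const (sub_pos.2 h))
  filter_upwards [ht.eventually_gt_atTop c] with k hk
  calc c * Real.exp (ν k * a) < Real.exp (ν k * (b - a)) * Real.exp (ν k * a) :=
        mul_lt_mul_of_pos_right hk (Real.exp_pos _)
    _ = _ := by rw [← Real.exp_add]; ring_nf

lemma limit_deriv_le {D : Set ℂ} (hDo : IsOpen D) {f : ℕ → ℂ → ℂ}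
    (hf : ∀ n, AnalyticOnNhd ℂ (f n) D) {ν : ℕ → ℕ} (hν : Tendsto ν atTop atTop)
    {u v : ℂ → EReal}
    (hu : TendstoSubharmonic D (fun k => scaledLog (ν k) (f (ν k))) u)
    (hv : TendstoSubharmonic D (fun k => scaledLog (ν k) (deriv (f (ν k)))) v)
    {z : ℂ} (hz : z ∈ D) : v z ≤ u z := by
  by_contra! hlt
  obtain ⟨b, hub, hbv⟩ := EReal.lt_iff_exists_real_btwn.1 hlt
  obtain ⟨a, hua, hab⟩ := EReal.lt_iff_exists_real_btwn.1 hub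
  rw [EReal.coe_lt_coe_iff] at hab
  obtain ⟨r₁, hr₁, hle⟩ := hu.eventually_forall_ball_le hDo hf hν hz hua
  obtain ⟨r₂, hr₂, hr₂D⟩ := Metric.nhds_basis_closedBall.mem_iff.1 (hDo.mem_nhds hz)
  -- Circles of radius `r` centred in `ball z r` stay within `2 * r` of `z`.
  set r := min r₁ r₂ / 3 with hr
  have hr0 : 0 < r := by positivity
  have h3 : 3 * r ≤ r₁ := by rw [hr]; linarith [min_le_left r₁ r₂]
  have h3' : 3 * r ≤ r₂ := by rw [hr]; linarith [min_le_right r₁ r₂]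
  have hrD : Metric.closedBall z r ⊆ D :=
    (Metric.closedBall_subset_closedBall (by linarith)).trans hr₂D
  obtain ⟨k, hk, ⟨y, hy, hky⟩, hkν, hkexp⟩ := (hle.and
    ((hv.eventually_exists_ball_lt hr0 hrD hbv).and
      ((hν.eventually_gt_atTop 0).and (eventually_mul_exp_lt (c := r⁻¹) hab hν)))).exists
  rw [lt_scaledLog_iff hkν] at hky
  have hyr : dist y z < r := hy
  have hsub : Metric.closedBall y r ⊆ D :=
    (Metric.closedBall_subset_closedBall' (by linarith)).trans hr₂D
  have hd : DiffContOnCl ℂ (f (ν k)) (Metric.ball y r) :=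
    DifferentiableOn.diffContOnCl_ball (hf (ν k)).differentiableOn hsub
  have hc := Complex.norm_deriv_le_of_forall_mem_sphere_norm_le hr0 hd fun x hx =>
    (scaledLog_le_iff hkν).1 (hk x (Metric.mem_ball.2 (by
      have := dist_triangle x y z
      rw [Metric.mem_sphere] at hx
      linarith)))
  rw [div_eq_inv_mul] at hc
  linarith

/-- Where `f'` is exponentially smaller than `f`, the limit function is locally constant. -/
lemma limit_le_of_deriv_le {D : Set ℂ} (hDo : IsOpen D) {f : ℕ → ℂ → ℂ}
    (hf : ∀ n, AnalyticOnNhd ℂ (f n) D) {ν : ℕ → ℕ} (hν : Tendsto ν atTop atTop)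
    {u : ℂ → EReal} (hu : TendstoSubharmonic D (fun k => scaledLog (ν k) (f (ν k))) u)
    {z₀ : ℂ} {r a : ℝ} (hrD : Metric.ball z₀ r ⊆ D)
    (hle : ∀ᶠ k in atTop, ∀ y ∈ Metric.ball z₀ r, scaledLog (ν k) (deriv (f (ν k))) y ≤ a)
    {z z' : ℂ} (hz : z ∈ Metric.ball z₀ r) (hz' : z' ∈ Metric.ball z₀ r) (ha : a < u z) :
    u z ≤ u z' := by
  by_contra! hlt
  obtain ⟨c, hc1, hc⟩ := EReal.lt_iff_exists_real_btwn.1 (max_lt ha hlt)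
  obtain ⟨b, hb1, hbc⟩ := EReal.lt_iff_exists_real_btwn.1 hc1
  obtain ⟨hab, hub⟩ := max_lt_iff.1 hb1
  rw [EReal.coe_lt_coe_iff] at hab hbc
  obtain ⟨t, ht, hbd⟩ := hu.eventually_forall_ball_le hDo hf hν (hrD hz') hub
  obtain ⟨s, hs, hsr⟩ := Metric.nhds_basis_closedBall.mem_iff.1 (Metric.isOpen_ball.mem_nhds hz)
  -- In `2 * r + 1`, the diameter comes from the mean value inequality and the `1` from `|f z'|`.
  obtain ⟨k, hk, hkb, ⟨y, hy, hky⟩, hkν, hkexp⟩ := (hle.and (hbd.and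
    ((hu.eventually_exists_ball_lt hs (hsr.trans hrD) hc).and
      ((hν.eventually_gt_atTop 0).and
        (eventually_mul_exp_lt (c := 2 * r + 1) hbc hν))))).exists
  rw [lt_scaledLog_iff hkν] at hky
  have hyb : y ∈ Metric.ball z₀ r := hsr (Metric.ball_subset_closedBall hy)
  have h1 := (scaledLog_le_iff hkν).1 (hkb z' (Metric.mem_ball_self ht))
  have h2 := (convex_ball z₀ r).norm_image_sub_le_of_norm_deriv_le (𝕜 := ℂ)
    (fun x hx => (hf (ν k) x (hrD hx)).differentiableAt)
    (fun x hx => (scaledLog_le_iff hkν).1 (hk x hx)) hz' hyb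
  have h3 : ‖y - z'‖ ≤ 2 * r := by
    rw [← dist_eq_norm]
    have := dist_triangle_right y z' z₀
    rw [Metric.mem_ball] at hyb hz'
    linarith
  have h4 : Real.exp (ν k * a) ≤ Real.exp (ν k * b) :=
    Real.exp_le_exp.2 (mul_le_mul_of_nonneg_left hab.le (Nat.cast_nonneg _))
  have h5 : Real.exp (ν k * a) * ‖y - z'‖ ≤ Real.exp (ν k * b) * (2 * r) :=
    mul_le_mul h4 h3 (norm_nonneg _) (Real.exp_nonneg _)
  have h6 := norm_le_norm_add_norm_sub (f (ν k) z') (f (ν k) y)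
  rw [norm_sub_rev] at h6
  linarith

theorem theorem2 (D : Set ℂ) (hDo : IsOpen D) (hDc : IsConnected D)
    (f : ℕ → ℂ → ℂ) (hf : ∀ n, AnalyticOnNhd ℂ (f n) D)
    (ν : ℕ → ℕ) (hν : StrictMono ν) (u v : ℂ → EReal)
    (hu_ne : ∃ z ∈ D, u z ≠ ⊥)
    (hu : TendstoSubharmonic D (fun k => scaledLog (ν k) (f (ν k))) u)
    (hv : TendstoSubharmonic D (fun k => scaledLog (ν k) (deriv (f (ν k)))) v) :
    (∀ z ∈ D, v z ≤ u z) ∧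
      ∀ z₀ ∈ D, v z₀ < u z₀ →
        ∃ V : Set ℂ, IsOpen V ∧ z₀ ∈ V ∧ V ⊆ D ∧ ∀ z ∈ V, u z = u z₀ := by
  refine ⟨fun z hz => limit_deriv_le hDo hf hν.tendsto_atTop hu hv hz, fun z₀ hz₀ hlt => ?_⟩
  obtain ⟨a, hva, hau⟩ := EReal.lt_iff_exists_real_btwn.1 hlt
  obtain ⟨r₁, hr₁, hle⟩ := hv.eventually_forall_ball_le (f := fun n => deriv (f n)) hDo
    (fun n => (hf n).deriv) hν.tendsto_atTop hz₀ hva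
  obtain ⟨r₂, hr₂, hr₂D⟩ := Metric.isOpen_iff.1 hDo z₀ hz₀
  have hrD : Metric.ball z₀ (min r₁ r₂) ⊆ D :=
    (Metric.ball_subset_ball (min_le_right _ _)).trans hr₂D
  have hle' := hle.mono fun k hk y (hy : y ∈ Metric.ball z₀ (min r₁ r₂)) =>
    hk y (Metric.ball_subset_ball (min_le_left _ _) hy)
  have hz₀V : z₀ ∈ Metric.ball z₀ (min r₁ r₂) := Metric.mem_ball_self (lt_min hr₁ hr₂)
  refine ⟨_, Metric.isOpen_ball, hz₀V, hrD, fun z hz => ?_⟩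
  have h1 := limit_le_of_deriv_le hDo hf hν.tendsto_atTop hu hrD hle' hz₀V hz hau
  -- The reverse inequality needs `a < u z`, which `h1` supplies.
  exact (limit_le_of_deriv_le hDo hf hν.tendsto_atTop hu hrD hle' hz hz₀V
    (hau.trans_le h1)).antisymm h1
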